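/- An $n$-tree ($n\ge 1$) is a directed tree with vertices named $1,\dots,n$ and edges named $1',\dots,(n-1)'$. A tree sequence of order $n$ is $\mathcal T=(T_1,\dots,T_n)$ with $T_m$ an $m$-tree. For an $n$-tree $T$ and $\mathbf k\in\mathbb Z^n$, a vector $\mathbf l\in\mathbb Z^{n-1}$ is admissible for $(T,\mathbf k)$ if for every edge $j'=(p,q)$ of $T$: $k_p+p\le l_j+j<k_q+q$ if $k_p+p<k_q+q$, and $k_q+q\le l_j+j<k_p+p$ otherwise; in the latter case $j'$ is an inversion of $(T,\mathbf k)$. A Gelfand-Tsetlin tree sequence for $(\mathcal T,\mathbf k)$ is $\mathbf L=(\mathbf l_1,\dots,\mathbf l_n)$ with $\mathbf l_m\in\mathbb Z^m$, $\mathbf l_n=\mathbf k$, and $\mathbf l_{m-1}$ admissible for $(T_m,\mathbf l_m)$ for $2\le m\le n$; its inversions are those of all the pairs $(T_m,\mathbf l_m)$, $2\le m\le n$. For a root $r$ of a tree $T$, an edge is reversed if it is not directed away from $r$; let $\pi$ be the permutation that lists $r$ and then, in the order of the edge names, the endpoint of each edge that is farther from $r$; put $\operatorname{sgn}T=(-1)^{\#\text{reversed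 edges}}\operatorname{sgn}\pi$, computed with root $1$. Put $\operatorname{sgn}\mathcal T=\prod_m\operatorname{sgn}T_m$ and $\operatorname{sgn}\mathbf L=(-1)^{\#\text{inversions}}\operatorname{sgn}\mathcal T$, and let $L_n(\mathcal T,\mathbf k)$ be the sum of $\operatorname{sgn}\mathbf L$ over the (finitely many) Gelfand-Tsetlin tree sequences for $(\mathcal T,\mathbf k)$. For $i<j$ let $\sigma_{i,j}\mathbf k$ denote the vector $\mathbf k$ with $(k_i,k_j)$ replaced by $(k_j+j-i,\;k_i+i-j)$ (and put $\sigma_{j,i}=\sigma_{i,j}$, $\sigma_{i,i}=\mathrm{id}$). A special tree sequence $\mathcal S$ of order $n$ for $(i,j)$ is a tree sequence with distinguished vertices $a_m,b_m$ of $T_m$ such that $a_n=i$, $b_n=j$, and for every $3\le m\le n$: the sinks of $T_m$ are exactly $a_m\neq b_m$, both are leaves, the edges at $a_m$ and $b_m$ start in the same vertex, and they are named $a_{m-1}'$ and $b_{m-1}'$. Then for every $n\ge1$: 1. (Independency) $L_n(\mathcal T,\mathbf k)=L_n(\mathcal T',\mathbf k)$ for all tree sequences $\mathcal T,\mathcal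 T'$ of order $n$ and all $\mathbf k\in\mathbb Z^n$. 2. (Shift-antisymmetry) $L_n(\mathcal T,\sigma_{i,j}\mathbf k)=-L_n(\mathcal T,\mathbf k)$ for all $\mathcal T$, all $1\le i<j\le n$ and all $\mathbf k\in\mathbb Z^n$. 3. For all $1\le i<j\le n$ there is a special tree sequence for $(i,j)$, and for every such $\mathcal S$ the map $(\mathbf l_m)_m\mapsto(\sigma_{a_m,b_m}\mathbf l_m)_m$ is an involution on the Gelfand-Tsetlin tree sequences of $\mathcal S$ that maps those for $(\mathcal S,\mathbf k)$ to those for $(\mathcal S,\sigma_{i,j}\mathbf k)$ and reverses the sign. 4. The sign of an $n$-tree is the same for every choice of the root. 5. Every $n$-tree can be transformed into every other $n$-tree by finitely many operations of the two kinds: reversing the orientation of one edge; sliding an edge along another, that is, for two different edges $e,f$ with a common vertex $q$, replacing $q$ as an endpoint of $e$ by the other endpoint of $f$. -/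

import Mathlib

namespace GelfandTsetlin

/-- A directed tree with `m + 1` vertices, named by `Fin (m + 1)`, and `m` edges, named by `Fin m`
(an `(m + 1)`-tree; the names `0, 1, 2, …` used here stand for `1, 2, 3, …`).  Edge `e` is directed
from `tail e` to `head e`.  As a tree on `m + 1` vertices has exactly `m` edges, the condition
`isTree` forces the `m` named edges to be distinct and not to be loops. -/
structure DTree (m : ℕ) where
  tail : Fin m → Fin (m + 1)
  head : Fin m → Fin (m + 1)
  isTree : (SimpleGraph.fromRel fun u v => ∃ e, tail e = u ∧ head e = v).IsTree

namespace DTree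

variable {m : ℕ}

/-- The underlying undirected graph. -/
def graph (T : DTree m) : SimpleGraph (Fin (m + 1)) :=
  SimpleGraph.fromRel fun u v => ∃ e, T.tail e = u ∧ T.head e = v

/-- Edge `e` is reversed with respect to the root `r` if it is not directed away from `r`. -/
def IsReversed (T : DTree m) (r : Fin (m + 1)) (e : Fin m) : Prop :=
  ¬ T.graph.dist r (T.tail e) < T.graph.dist r (T.head e)

/-- The head of the edge `e` with respect to the standard orientation, in which all edges are
directed away from the root `r`. -/
noncomputable def stdHead (T : DTree m) (r : Fin (m + 1)) (e : Fin m) : Fin (m + 1) :=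
  open Classical in if T.IsReversed r e then T.tail e else T.head e

/-- The word that starts with the root `r`, followed by the heads of the edges in the standard
orientation, in the order of the edge names. -/
noncomputable def rootWord (T : DTree m) (r : Fin (m + 1)) : Fin (m + 1) → Fin (m + 1) :=
  Fin.cons r (T.stdHead r)

/-- The word `rootWord` is a permutation. -/
theorem rootWord_bijective (T : DTree m) (r : Fin (m + 1)) :
    Function.Bijective (T.rootWord r) := by
  rw [← Finite.surjective_iff_bijective]
  intro v
  by_cases hv : v = r
  · exact ⟨0, by simp [rootWord, hv]⟩
  have hT : T.graph.IsTree := T.isTree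
  obtain ⟨p, hp⟩ := (hT.connected v r).exists_walk_length_eq_dist
  cases p with
  | nil => exact absurd rfl hv
  | @cons _ u _ h q =>
    have hlt : T.graph.dist r u < T.graph.dist r v := by
      rw [SimpleGraph.dist_comm, SimpleGraph.dist_comm (u := r)]
      have := SimpleGraph.dist_le q
      rw [SimpleGraph.Walk.length_cons] at hp
      omega
    have h' := h
    rw [graph, SimpleGraph.fromRel_adj] at h'
    rcases h'.2 with ⟨e, h1, h2⟩ | ⟨e, h1, h2⟩
    · refine ⟨e.succ, ?_⟩
      simp only [rootWord, Fin.cons_succ, stdHead, IsReversed, h1, h2]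
      rw [if_pos (by omega)]
    · refine ⟨e.succ, ?_⟩
      simp only [rootWord, Fin.cons_succ, stdHead, IsReversed, h1, h2]
      rw [if_neg (by omega)]

/-- The permutation associated with a tree and a root. -/
noncomputable def rootPerm (T : DTree m) (r : Fin (m + 1)) : Equiv.Perm (Fin (m + 1)) :=
  Equiv.ofBijective (T.rootWord r) (T.rootWord_bijective r)

/-- The sign of a tree, computed with the root `r`. -/
noncomputable def sgnAt (T : DTree m) (r : Fin (m + 1)) : ℤ :=
  (-1) ^ {e | T.IsReversed r e}.ncard * (Equiv.Perm.sign (T.rootPerm r) : ℤ)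

/-- The sign of a tree (computed with the first vertex as root). -/
noncomputable def sgn (T : DTree m) : ℤ := T.sgnAt 0

end DTree

/-- The label `k_i + i` that belongs to the shifted labeling `k` (with names counted from `1`). -/
def label {m : ℕ} (k : Fin m → ℤ) (i : Fin m) : ℤ := k i + ((i : ℕ) : ℤ) + 1

namespace DTree

variable {m : ℕ}

/-- `l` is an admissible shifted edge labeling for the tree `T` with shifted vertex labeling `k`. -/
def Admissible (T : DTree m) (k : Fin (m + 1) → ℤ) (l : Fin m → ℤ) : Prop :=
  ∀ e : Fin m,
    if label k (T.tail e) < label k (T.head e) then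
      label k (T.tail e) ≤ label l e ∧ label l e < label k (T.head e)
    else
      label k (T.head e) ≤ label l e ∧ label l e < label k (T.tail e)

/-- Edge `e` is an inversion of the pair `(T, k)`. -/
def IsInversion (T : DTree m) (k : Fin (m + 1) → ℤ) (e : Fin m) : Prop :=
  ¬ label k (T.tail e) < label k (T.head e)

/-- The number of inversions of the pair `(T, k)`. -/
noncomputable def inv (T : DTree m) (k : Fin (m + 1) → ℤ) : ℕ :=
  {e | T.IsInversion k e}.ncard

/-- `T'` arises from `T` by reversing the orientation of a single edge. -/
def IsReversal (T T' : DTree m) : Prop :=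
  ∃ e : Fin m, T'.tail = Function.update T.tail e (T.head e) ∧
    T'.head = Function.update T.head e (T.tail e)

/-- `T'` arises from `T` by sliding an edge `e` along another edge `f`: the edges have a vertex
`q` in common, and in `e` it is replaced by the other endpoint `r` of `f`. -/
def IsSlide (T T' : DTree m) : Prop :=
  ∃ (e f : Fin m) (q r : Fin (m + 1)), e ≠ f ∧ s(T.tail f, T.head f) = s(q, r) ∧
    ((T.tail e = q ∧ T'.tail = Function.update T.tail e r ∧ T'.head = T.head) ∨
      (T.head e = q ∧ T'.head = Function.update T.head e r ∧ T'.tail = T.tail))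

/-- A tree with exactly two sinks `a` and `b`; these are leaves, the edge at `a` is `e`, the edge
at `b` is `f`, and `e` and `f` start in the same vertex. -/
def IsFork (T : DTree m) (a b : Fin (m + 1)) (e f : Fin m) : Prop :=
  a ≠ b ∧ {v | ∀ e', T.tail e' ≠ v} = {a, b} ∧
    (∀ e', T.head e' = a ↔ e' = e) ∧ (∀ e', T.head e' = b ↔ e' = f) ∧ T.tail e = T.tail f

end DTree

/-- A tree sequence of order `n + 1`: `T m` is a tree with `m + 1` vertices for `m = 0, …, n`. -/
abbrev TreeSeq (n : ℕ) : Type := (m : Fin (n + 1)) → DTree m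

/-- The sign of a tree sequence. -/
noncomputable def TreeSeq.sgn {n : ℕ} (T : TreeSeq n) : ℤ := ∏ m, (T m).sgn

/-- A Gelfand-Tsetlin tree sequence associated with the tree sequence `T` of order `n + 1` and the
shifted labeling `k` of the vertices of the largest tree; `lab m` is the shifted labeling of the
vertices of `T m`, and at the same time of the edges of the next larger tree. -/
@[ext]
structure GTSeq {n : ℕ} (T : TreeSeq n) (k : Fin (n + 1) → ℤ) where
  lab : (m : Fin (n + 1)) → Fin (m + 1) → ℤ
  top : lab (Fin.last n) = k
  adm : ∀ m : Fin n, (T m.succ).Admissible (lab m.succ) (lab m.castSucc)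

namespace GTSeq

variable {n : ℕ} {T : TreeSeq n} {k : Fin (n + 1) → ℤ}

/-- The sign of a Gelfand-Tsetlin tree sequence. -/
noncomputable def sgn (L : GTSeq T k) : ℤ :=
  (-1) ^ (∑ m : Fin n, (T m.succ).inv (L.lab m.succ)) * T.sgn

/-- All labels lie between any bounds for the labels of the largest tree. -/
theorem label_bounds (L : GTSeq T k) (lo hi : ℤ) (h : ∀ i, lo ≤ label k i ∧ label k i ≤ hi)
    (m : Fin (n + 1)) : ∀ i, lo ≤ label (L.lab m) i ∧ label (L.lab m) i ≤ hi := by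
  induction m using Fin.reverseInduction with
  | last => rw [L.top]; exact h
  | cast m ih =>
    intro e
    have h1 := L.adm m e
    have h2 := ih ((T m.succ).tail e)
    have h3 := ih ((T m.succ).head e)
    change lo ≤ label (m := (m.succ : ℕ)) (L.lab m.castSucc) e ∧
      label (m := (m.succ : ℕ)) (L.lab m.castSucc) e ≤ hi
    split_ifs at h1 <;> constructor <;> linarith [h1.1, h1.2, h2.1, h2.2, h3.1, h3.2]

/-- There are only finitely many Gelfand-Tsetlin tree sequences for given `T` and `k`. -/
instance : Finite (GTSeq T k) := by
  obtain ⟨hi, hhi⟩ := (Set.finite_range (label k)).bddAbove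
  obtain ⟨lo, hlo⟩ := (Set.finite_range (label k)).bddBelow
  have h : ∀ i, lo ≤ label k i ∧ label k i ≤ hi :=
    fun i => ⟨hlo ⟨i, rfl⟩, hhi ⟨i, rfl⟩⟩
  let F : GTSeq T k → ((m : Fin (n + 1)) → Fin (m + 1) → Set.Icc lo hi) :=
    fun L m i => ⟨label (L.lab m) i, L.label_bounds lo hi h m i⟩
  refine Finite.of_injective F fun L L' hL => ?_
  ext m i
  have := congrArg Subtype.val (congrFun (congrFun hL m) i)
  simpa [F, label] using this

end GTSeq

/-- The signed enumeration `L_{n+1}(T, k)` of the (finitely many) Gelfand-Tsetlin tree sequences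
associated with `T` and `k`. -/
noncomputable def signedCount {n : ℕ} (T : TreeSeq n) (k : Fin (n + 1) → ℤ) : ℤ :=
  ∑ᶠ L : GTSeq T k, L.sgn

/-- The replacement `(k_i, k_j) ↦ (k_j + j - i, k_i + i - j)`, that is, the interchange of the
labels `k_i + i` and `k_j + j`. -/
def shiftSwap {m : ℕ} (i j : Fin m) (k : Fin m → ℤ) : Fin m → ℤ := fun v =>
  if v = i then k j + ((j : ℕ) : ℤ) - ((i : ℕ) : ℤ)
  else if v = j then k i + ((i : ℕ) : ℤ) - ((j : ℕ) : ℤ)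
  else k v

/-- Shift-antisymmetry of a function on `ℤ^m`. -/
def ShiftAntisymmetric {m : ℕ} (f : (Fin m → ℤ) → ℤ) : Prop :=
  ∀ (i j : Fin m), i < j → ∀ k, f k = - f (shiftSwap i j k)

/-- The special tree sequences for `i` and `j`: the trees with at least three vertices have exactly
two sinks `a m` and `b m`, which are leaves with a common neighbour; in the largest tree the sinks
are `i` and `j`, and the edges at the two sinks of a tree have the names of the two distinguished
vertices of the next smaller tree. -/
structure IsForkSeq {n : ℕ} (S : TreeSeq n) (i j : Fin (n + 1))
    (a b : (m : Fin (n + 1)) → Fin (m + 1)) : Prop where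
  top_left : a (Fin.last n) = i
  top_right : b (Fin.last n) = j
  fork : ∀ m : Fin n, 1 ≤ (m : ℕ) →
    (S m.succ).IsFork (a m.succ) (b m.succ) (a m.castSucc) (b m.castSucc)

end GelfandTsetlin

open GelfandTsetlin

/-! Independency and shift-antisymmetry are proved together by induction on the order.

In the labels `k_i + i`, a shift-swap is a plain transposition of two labels. Each edge contributes
a signed indicator function of the interval between the labels of its ends (`signedInd`); the
product over the edges is the weight of the tree, which is `(-1)^inversions` on admissible edge
labelings and `0` elsewhere (`weight_label`). Cutting off the largest tree writes `signedCount` as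
the sign of that tree times the sum of its weight against `signedCount` of one order less
(`signedCount_succ`).

By induction the smaller count does not depend on its tree sequence, so a special sequence may be
used for it; there the involution that swaps the distinguished labels reverses signs, which makes
the smaller count antisymmetric. It remains to change the largest tree. A reversal negates both sign
and weight. A slide keeps the sign and, because signed indicators are additive, changes the weight
by a function symmetric in two edge labels, which sums to zero against an antisymmetric function
(`sgn_mul_sum_weight`). Since reversals and slides connect all trees (`reach`), independency
follows, and antisymmetry follows from it.

The behaviour of the sign under the two operations, and its independence of the root, come from
writing it as a determinant of the incidence matrix extended by a root row (`sgnAt_eq_det`). -/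

namespace GelfandTsetlin

/-! ### Trees as connected edge families; transitivity of reversals and slides -/

namespace DTree

variable {m : ℕ}

/-- A set of vertices that contains `0` and with each edge either both or none of its ends
contains all vertices. -/
theorem mem_of_closed (T : DTree m) (S : Set (Fin (m + 1))) (h0 : 0 ∈ S)
    (h : ∀ e, T.tail e ∈ S ↔ T.head e ∈ S) (v : Fin (m + 1)) : v ∈ S := by
  have hT : T.graph.IsTree := T.isTree
  obtain ⟨p⟩ := hT.connected v 0
  generalize (0 : Fin (m + 1)) = z at h0 p
  induction p with
  | nil => exact h0
  | @cons u v w hadj p ih =>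
    have h2 := ih h0
    rw [graph, SimpleGraph.fromRel_adj] at hadj
    rcases hadj.2 with ⟨e, h3, h4⟩ | ⟨e, h3, h4⟩
    · have := h e
      rw [h3, h4] at this
      exact this.2 h2
    · have := h e
      rw [h3, h4] at this
      exact this.1 h2

theorem edgeSet_subset_range (tail head : Fin m → Fin (m + 1)) :
    (SimpleGraph.fromRel fun u v => ∃ e, tail e = u ∧ head e = v).edgeSet ⊆
      Set.range fun e => s(tail e, head e) := by
  intro x hx
  induction x with
  | _ u v =>
    rw [SimpleGraph.mem_edgeSet, SimpleGraph.fromRel_adj] at hx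
    rcases hx.2 with ⟨e, rfl, rfl⟩ | ⟨e, rfl, rfl⟩
    · exact ⟨e, rfl⟩
    · exact ⟨e, Sym2.eq_swap⟩

/-- The converse of `mem_of_closed`: `m` edges that connect `m + 1` vertices form a tree. -/
theorem isTree_of_closed (tail head : Fin m → Fin (m + 1))
    (h : ∀ S : Set (Fin (m + 1)), 0 ∈ S → (∀ e, tail e ∈ S ↔ head e ∈ S) → ∀ v, v ∈ S) :
    (SimpleGraph.fromRel fun u v => ∃ e, tail e = u ∧ head e = v).IsTree := by
  set G := SimpleGraph.fromRel fun u v => ∃ e, tail e = u ∧ head e = v with hG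
  have key : ∀ v, G.Reachable 0 v := by
    refine h {v | G.Reachable 0 v} (SimpleGraph.Reachable.refl 0) fun e => ?_
    by_cases heq : tail e = head e
    · rw [heq]
    · have hadj : G.Adj (tail e) (head e) := by
        rw [hG, SimpleGraph.fromRel_adj]
        exact ⟨heq, Or.inl ⟨e, rfl, rfl⟩⟩
      exact ⟨fun h => h.trans hadj.reachable, fun h => h.trans hadj.symm.reachable⟩
  have hconn : G.Connected :=
    { preconnected := fun u v => (key u).symm.trans (key v), nonempty := ⟨0⟩ }
  rw [SimpleGraph.isTree_iff_connected_and_card]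
  -- Connectivity forces at least `m` edges, and only `m` names are available.
  refine ⟨hconn, le_antisymm ?_ hconn.card_vert_le_card_edgeSet_add_one⟩
  have h1 := Set.ncard_le_ncard (edgeSet_subset_range tail head) (Set.toFinite _)
  have h2 : (Set.range fun e => s(tail e, head e)).ncard ≤ m := by
    rw [← Set.image_univ]
    refine (Set.ncard_image_le (Set.toFinite _)).trans ?_
    simp [Set.ncard_univ]
  rw [← Nat.card_coe_set_eq] at h1
  simpa using h1.trans h2

/-- The ends of an edge, without its orientation. -/
def ends (T : DTree m) (e : Fin m) : Sym2 (Fin (m + 1)) := s(T.tail e, T.head e)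

/-- A counting argument: the tree has exactly `m` edges and all of them occur among the values of
`ends` at `m` names, so no name is wasted on a loop or a repetition. -/
theorem range_ends (T : DTree m) : T.graph.edgeSet = Set.range T.ends ∧
    Function.Injective T.ends := by
  have hT : T.graph.IsTree := T.isTree
  have h0 := (SimpleGraph.isTree_iff_connected_and_card.1 hT).2
  have h1 : T.graph.edgeSet ⊆ Set.range T.ends := edgeSet_subset_range T.tail T.head
  have h2 : (Set.range T.ends).ncard ≤ m := by
    rw [← Set.image_univ]
    refine (Set.ncard_image_le (Set.toFinite _)).trans ?_
    simp [Set.ncard_univ]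
  have h3 : T.graph.edgeSet.ncard = m := by
    rw [← Nat.card_coe_set_eq]
    simpa using h0
  have h4 : T.graph.edgeSet = Set.range T.ends :=
    Set.eq_of_subset_of_ncard_le h1 (by omega) (Set.toFinite _)
  refine ⟨h4, ?_⟩
  rw [← Set.injOn_univ, ← Set.ncard_image_iff (Set.toFinite _), Set.image_univ, ← h4, h3]
  simp [Set.ncard_univ]

theorem ends_injective (T : DTree m) : Function.Injective T.ends := T.range_ends.2

theorem adj (T : DTree m) (e : Fin m) : T.graph.Adj (T.tail e) (T.head e) := by
  rw [← SimpleGraph.mem_edgeSet, T.range_ends.1]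
  exact ⟨e, rfl⟩

/-- Reachability by reversals and slides. -/
abbrev Reach (T T' : DTree m) : Prop :=
  Relation.ReflTransGen (fun U V : DTree m => U.IsReversal V ∨ U.IsSlide V) T T'

theorem IsReversal.symm {T T' : DTree m} (h : T.IsReversal T') : T'.IsReversal T := by
  obtain ⟨e, h1, h2⟩ := h
  refine ⟨e, ?_, ?_⟩ <;> simp [h1, h2]

theorem IsSlide.symm {T T' : DTree m} (h : T.IsSlide T') : T'.IsSlide T := by
  obtain ⟨e, f, q, r, hef, hf, h | h⟩ := h
  · obtain ⟨h1, h2, h3⟩ := h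
    refine ⟨e, f, r, q, hef, ?_, Or.inl ⟨by simp [h2], by simp [h2, ← h1], h3.symm⟩⟩
    rw [h2, h3, Function.update_of_ne hef.symm, hf, Sym2.eq_swap]
  · obtain ⟨h1, h2, h3⟩ := h
    refine ⟨e, f, r, q, hef, ?_, Or.inr ⟨by simp [h2], by simp [h2, ← h1], h3.symm⟩⟩
    rw [h2, h3, Function.update_of_ne hef.symm, hf, Sym2.eq_swap]

theorem Reach.symm {T T' : DTree m} (h : Reach T T') : Reach T' T :=
  haveI : Std.Symm fun U V : DTree m => U.IsReversal V ∨ U.IsSlide V :=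
    ⟨fun _ _ h => h.imp IsReversal.symm IsSlide.symm⟩
  Relation.ReflTransGen.stdSymm.symm _ _ h

theorem ext_of_eq {T T' : DTree m} (h1 : T.tail = T'.tail) (h2 : T.head = T'.head) : T = T' := by
  cases T; cases T'; simp_all

/-- The reversal of an edge. -/
theorem exists_reversal (T : DTree m) (e : Fin m) :
    ∃ T' : DTree m, T'.tail = Function.update T.tail e (T.head e) ∧
      T'.head = Function.update T.head e (T.tail e) := by
  refine ⟨⟨Function.update T.tail e (T.head e), Function.update T.head e (T.tail e),
    isTree_of_closed _ _ fun S h0 h => T.mem_of_closed S h0 fun f => ?_⟩, rfl, rfl⟩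
  have := h f
  by_cases hf : f = e
  · subst hf
    simpa using this.symm
  · simpa [hf] using this

/-- Only orientations differ, so the wrongly oriented edges can be reversed one at a time. From here
on slides can be treated as operations on undirected edges. -/
theorem reach_of_ends_eq {T T' : DTree m} (h : T.ends = T'.ends) : Reach T T' := by
  classical
  induction hn : (Finset.univ.filter fun e => T.tail e ≠ T'.tail e).card generalizing T with
  | zero =>
    have h1 : T.tail = T'.tail := by
      funext e
      by_contra hne
      rw [Finset.card_eq_zero] at hn
      have : e ∈ (Finset.univ.filter fun e => T.tail e ≠ T'.tail e) := by simpa using hne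
      simp [hn] at this
    have h2 : T.head = T'.head := by
      funext e
      have := congrFun h e
      simp only [ends, h1] at this
      exact Sym2.congr_right.1 this
    rw [ext_of_eq h1 h2]
  | succ n ih =>
    obtain ⟨e, he⟩ : (Finset.univ.filter fun e => T.tail e ≠ T'.tail e).Nonempty := by
      rw [← Finset.card_pos]; omega
    obtain ⟨U, hU1, hU2⟩ := T.exists_reversal e
    have hte : T.tail e ≠ T'.tail e := by simpa using he
    have hends : U.ends = T.ends := by
      funext f
      by_cases hf : f = e
      · subst hf; simp [ends, hU1, hU2, Sym2.eq_swap]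
      · simp [ends, hU1, hU2, hf]
    have hhe : T.head e = T'.tail e := by
      have := congrFun h e
      simp only [ends, Sym2.eq_iff] at this
      tauto
    refine Relation.ReflTransGen.head (Or.inl ⟨e, hU1, hU2⟩) (ih (hends.trans h) ?_)
    have : (Finset.univ.filter fun f => U.tail f ≠ T'.tail f) =
        (Finset.univ.filter fun f => T.tail f ≠ T'.tail f).erase e := by
      ext f
      by_cases hf : f = e
      · subst hf; simp [hU1, hhe]
      · simp [hU1, hf]
    rw [this, Finset.card_erase_of_mem he, hn]
    rfl

/-- The slide of the edge `e` along the edge `f`. -/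
theorem exists_slide (T : DTree m) {e f : Fin m} {p q r : Fin (m + 1)} (hef : e ≠ f)
    (he : T.ends e = s(q, p)) (hf : T.ends f = s(q, r)) :
    ∃ T' : DTree m, Reach T T' ∧ T'.ends = Function.update T.ends e s(r, p) := by
  have hcl : ∀ S : Set (Fin (m + 1)), (T.tail f ∈ S ↔ T.head f ∈ S) → (q ∈ S ↔ r ∈ S) := by
    intro S hS
    simp only [ends, Sym2.eq_iff] at hf
    rcases hf with ⟨h1, h2⟩ | ⟨h1, h2⟩
    · rw [← h1, ← h2, hS]
    · rw [← h1, ← h2, hS]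
  have hcases := he
  simp only [ends, Sym2.eq_iff] at hcases
  rcases hcases with ⟨h1, h2⟩ | ⟨h1, h2⟩
  · refine ⟨⟨Function.update T.tail e r, T.head,
      isTree_of_closed _ _ fun S h0 h => T.mem_of_closed S h0 fun g => ?_⟩,
      Relation.ReflTransGen.single (Or.inr ⟨e, f, q, r, hef, hf, Or.inl ⟨h1, rfl, rfl⟩⟩), ?_⟩
    · have hg := h g
      have hf' := h f
      by_cases hge : g = e
      · subst hge
        rw [Function.update_of_ne hef.symm] at hf'
        rw [Function.update_self] at hg
        rw [← hg, h1, hcl S hf']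
      · rwa [Function.update_of_ne hge] at hg
    · funext g
      by_cases hge : g = e
      · subst hge; simp [ends, h2]
      · simp [ends, hge]
  · refine ⟨⟨T.tail, Function.update T.head e r,
      isTree_of_closed _ _ fun S h0 h => T.mem_of_closed S h0 fun g => ?_⟩,
      Relation.ReflTransGen.single (Or.inr ⟨e, f, q, r, hef, hf, Or.inr ⟨h2, rfl, rfl⟩⟩), ?_⟩
    · have hg := h g
      have hf' := h f
      by_cases hge : g = e
      · subst hge
        rw [Function.update_of_ne hef.symm] at hf'
        rw [Function.update_self] at hg
        rw [hg, h2, hcl S hf']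
      · rwa [Function.update_of_ne hge] at hg
    · funext g
      by_cases hge : g = e
      · subst hge; simp [ends, h1, Sym2.eq_swap]
      · simp [ends, hge]

/-- The underlying undirected tree is the star with centre `0` in which the edge `e` ends in
`(σ e).succ`. -/
def IsStar (T : DTree m) (σ : Equiv.Perm (Fin m)) : Prop := ∀ e, T.ends e = s(0, (σ e).succ)

theorem exists_star_of_zero_mem (T : DTree m) (h : ∀ e, (0 : Fin (m + 1)) ∈ T.ends e) :
    ∃ σ, T.IsStar σ := by
  have h1 : ∀ e, ∃ x : Fin m, T.ends e = s(0, x.succ) := by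
    intro e
    obtain ⟨y, hy⟩ := h e
    have hne : y ≠ 0 := by
      rintro rfl
      have h2 : T.ends e ∈ T.graph.edgeSet := by
        rw [T.range_ends.1]; exact ⟨e, rfl⟩
      rw [hy, SimpleGraph.mem_edgeSet] at h2
      exact h2.ne rfl
    obtain ⟨x, rfl⟩ := Fin.exists_succ_eq.2 hne
    exact ⟨x, hy⟩
  choose g hg using h1
  have hinj : Function.Injective g := fun e f hef =>
    T.ends_injective (by rw [hg, hg, hef])
  exact ⟨Equiv.ofBijective g (Finite.injective_iff_bijective.1 hinj), hg⟩

/-- Otherwise `0` together with its neighbours would be closed under edges, hence would be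
everything, and every edge, including `e₀`, would contain `0`. -/
theorem exists_edge_at_neighbor (T : DTree m) (e₀ : Fin m)
    (h : (0 : Fin (m + 1)) ∉ T.ends e₀) :
    ∃ e f p q, T.ends e = s(q, p) ∧ T.ends f = s(q, 0) ∧ (0 : Fin (m + 1)) ∉ T.ends e := by
  by_contra! hcon
  have key := T.mem_of_closed {v | v = 0 ∨ ∃ f, T.ends f = s(v, 0)} (Or.inl rfl) fun e => by
    simp only [Set.mem_ofPred_eq]
    by_cases h1 : T.tail e = 0
    · exact iff_of_true (Or.inl h1) (Or.inr ⟨e, by rw [ends, h1, Sym2.eq_swap]⟩)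
    by_cases h2 : T.head e = 0
    · exact iff_of_true (Or.inr ⟨e, by rw [ends, h2]⟩) (Or.inl h2)
    have h3 : (0 : Fin (m + 1)) ∉ T.ends e := by
      simp only [ends, Sym2.mem_iff]
      tauto
    simp only [h1, h2, false_or]
    refine iff_of_false ?_ ?_
    · rintro ⟨f, hf⟩
      exact h3 (hcon e f _ _ rfl hf)
    · rintro ⟨f, hf⟩
      exact h3 (hcon e f _ _ Sym2.eq_swap hf)
  have h1 : T.tail e₀ ≠ 0 := by
    intro h1
    exact h (by simp [ends, h1])
  rcases key (T.tail e₀) with h2 | ⟨f, hf⟩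
  · exact h1 h2
  · exact h (hcon e₀ f _ _ rfl hf)

/-- An edge that misses `0` but touches a neighbour of `0` can be slid onto `0`; this lowers the
number of edges that miss `0`. -/
theorem exists_reach_star (T : DTree m) : ∃ T' σ, Reach T T' ∧ T'.IsStar σ := by
  classical
  induction hn : (Finset.univ.filter fun e => (0 : Fin (m + 1)) ∉ T.ends e).card
    using Nat.strong_induction_on generalizing T with
  | _ n ih =>
    by_cases hall : ∀ e, (0 : Fin (m + 1)) ∈ T.ends e
    · obtain ⟨σ, hσ⟩ := T.exists_star_of_zero_mem hall
      exact ⟨T, σ, Relation.ReflTransGen.refl, hσ⟩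
    · push Not at hall
      obtain ⟨e₀, he₀⟩ := hall
      obtain ⟨e, f, p, q, he, hf, h0⟩ := T.exists_edge_at_neighbor e₀ he₀
      have hef : e ≠ f := by
        rintro rfl
        exact h0 (by simp [hf])
      obtain ⟨U, hU, hUe⟩ := T.exists_slide hef he hf
      have hlt : (Finset.univ.filter fun g => (0 : Fin (m + 1)) ∉ U.ends g).card < n := by
        rw [← hn]
        refine Finset.card_lt_card ⟨fun g hg => ?_, fun hsub => ?_⟩
        · by_cases hge : g = e
          · subst hge; simp [hUe] at hg
          · simpa [hUe, hge] using hg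
        · have := hsub (Finset.mem_filter.2 ⟨Finset.mem_univ e, h0⟩)
          simp [hUe] at this
      obtain ⟨T', σ, h1, h2⟩ := ih _ hlt U rfl
      exact ⟨T', σ, hU.trans h1, h2⟩

/-- Three slides exchange two edge names of a star. With `e = {0, x}` and `f = {0, y}`: `e` along
`f` gives `e = {y, x}`, then `f` along `e` gives `f = {0, x}`, then `e` along `f` gives `e = {0,
y}`. -/
theorem IsStar.exists_reach_swap {T : DTree m} {σ : Equiv.Perm (Fin m)} (h : T.IsStar σ)
    {e f : Fin m} (hef : e ≠ f) : ∃ T', Reach T T' ∧ T'.IsStar (σ * Equiv.swap e f) := by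
  obtain ⟨T₁, h1, he1⟩ := T.exists_slide hef (h e) (h f)
  obtain ⟨T₂, h2, he2⟩ := T₁.exists_slide (e := f) (f := e) (q := (σ f).succ) (p := 0)
    (r := (σ e).succ) hef.symm
    (by rw [he1, Function.update_of_ne hef.symm, h f, Sym2.eq_swap]) (by simp [he1])
  obtain ⟨T₃, h3, he3⟩ := T₂.exists_slide (e := e) (f := f) (q := (σ e).succ) (p := (σ f).succ)
    (r := 0) hef
    (by rw [he2, Function.update_of_ne hef, he1, Function.update_self, Sym2.eq_swap])
    (by simp [he2])
  refine ⟨T₃, (h1.trans h2).trans h3, fun g => ?_⟩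
  by_cases hge : g = e
  · subst hge; simp [he3]
  by_cases hgf : g = f
  · subst hgf; simp [he3, he2, hge, Sym2.eq_swap]
  · simp [he3, he2, he1, hge, hgf, h g, Equiv.swap_apply_of_ne_of_ne hge hgf]

theorem IsStar.exists_reach_mul {T : DTree m} {σ : Equiv.Perm (Fin m)} (h : T.IsStar σ)
    (τ : Equiv.Perm (Fin m)) : ∃ T', Reach T T' ∧ T'.IsStar (σ * τ) := by
  induction τ using Equiv.Perm.swap_induction_on generalizing T σ with
  | one => exact ⟨T, Relation.ReflTransGen.refl, by simpa using h⟩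
  | swap_mul τ x y hxy ih =>
    obtain ⟨U, hU, hs⟩ := h.exists_reach_swap hxy
    obtain ⟨V, hV, hs'⟩ := ih hs
    exact ⟨V, hU.trans hV, by rwa [← mul_assoc]⟩

/-- Reversals and slides act transitively on the trees with `m + 1` vertices. -/
theorem reach (T T' : DTree m) : Reach T T' := by
  have key : ∀ T : DTree m, ∃ U, Reach T U ∧ U.IsStar 1 := fun T => by
    obtain ⟨U, σ, hU, hs⟩ := T.exists_reach_star
    obtain ⟨V, hV, hs'⟩ := hs.exists_reach_mul σ⁻¹
    exact ⟨V, hU.trans hV, by rwa [mul_inv_cancel] at hs'⟩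
  obtain ⟨U, hU, hs⟩ := key T
  obtain ⟨U', hU', hs'⟩ := key T'
  exact (hU.trans (reach_of_ends_eq (funext fun e => (hs e).trans (hs' e).symm))).trans hU'.symm

end DTree

/-! ### The sign of a tree as a determinant -/

namespace DTree

variable {m : ℕ}

/-- The incidence matrix of a tree, with the row `x` added at the top. -/
def incMatrix (T : DTree m) (x : Fin (m + 1) → ℤ) : Matrix (Fin (m + 1)) (Fin (m + 1)) ℤ :=
  Matrix.of (Fin.cons x fun e => Pi.single (T.head e) 1 - Pi.single (T.tail e) 1)

theorem incMatrix_zero (T : DTree m) (x : Fin (m + 1) → ℤ) : T.incMatrix x 0 = x := rfl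

theorem incMatrix_succ (T : DTree m) (x : Fin (m + 1) → ℤ) (e : Fin m) :
    T.incMatrix x e.succ = Pi.single (T.head e) 1 - Pi.single (T.tail e) 1 := rfl

theorem updateRow_incMatrix (T : DTree m) (x y : Fin (m + 1) → ℤ) :
    (T.incMatrix x).updateRow 0 y = T.incMatrix y := by
  ext i : 1
  refine Fin.cases ?_ (fun e => ?_) i
  · rw [Matrix.updateRow_self, incMatrix_zero]
  · rw [Matrix.updateRow_ne (Fin.succ_ne_zero e), incMatrix_succ, incMatrix_succ]

/-- Adding the row of `e` to the root row moves the root from the tail of `e` to its head. Along the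
connected tree this yields independence of the root. -/
theorem det_incMatrix_tail (T : DTree m) (e : Fin m) :
    (T.incMatrix (Pi.single (T.tail e) 1)).det = (T.incMatrix (Pi.single (T.head e) 1)).det := by
  have h := Matrix.det_updateRow_add_smul_self (T.incMatrix (Pi.single (T.tail e) 1))
    (Fin.succ_ne_zero e).symm 1
  rw [updateRow_incMatrix, incMatrix_zero, incMatrix_succ, one_smul, add_sub_cancel] at h
  exact h.symm

theorem det_incMatrix_root (T : DTree m) (r : Fin (m + 1)) :
    (T.incMatrix (Pi.single r 1)).det = (T.incMatrix (Pi.single 0 1)).det :=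
  T.mem_of_closed {r | (T.incMatrix (Pi.single r 1)).det = (T.incMatrix (Pi.single 0 1)).det} rfl
    (fun e => by simp only [Set.mem_ofPred_eq, det_incMatrix_tail]) r

/-- The tail of an edge if all edges are directed away from the root. -/
noncomputable def stdTail (T : DTree m) (r : Fin (m + 1)) (e : Fin m) : Fin (m + 1) :=
  open Classical in if T.IsReversed r e then T.head e else T.tail e

theorem dist_stdTail_lt (T : DTree m) (r : Fin (m + 1)) (e : Fin m) :
    T.graph.dist r (T.stdTail r e) < T.graph.dist r (T.stdHead r e) := by
  have hT : T.graph.IsTree := T.isTree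
  have := hT.dist_ne_of_adj r (T.adj e)
  unfold stdTail stdHead
  split_ifs with h
  · unfold IsReversed at h; omega
  · unfold IsReversed at h; omega

/-- Once the rows are permuted so that each edge row is indexed by its far end, the matrix is
unitriangular with respect to the distance from `r`: the only other nonzero entry of a row sits at
the parent, which is nearer to `r`. The row permutation accounts for the sign. -/
theorem det_stdMatrix (T : DTree m) (r : Fin (m + 1)) :
    (Matrix.of (Fin.cons (Pi.single r 1) fun e =>
      Pi.single (T.stdHead r e) 1 - Pi.single (T.stdTail r e) 1) :
      Matrix (Fin (m + 1)) (Fin (m + 1)) ℤ).det = Equiv.Perm.sign (T.rootPerm r) := by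
  set N : Matrix (Fin (m + 1)) (Fin (m + 1)) ℤ := Matrix.of (Fin.cons (Pi.single r 1) fun e =>
      Pi.single (T.stdHead r e) 1 - Pi.single (T.stdTail r e) 1) with hN
  set Q := N.submatrix (T.rootPerm r).symm id with hQ
  have hNQ : N = Q.submatrix (T.rootPerm r) id := by
    rw [hQ, Matrix.submatrix_submatrix]
    simp
  have hrow : ∀ i j, Q (T.rootPerm r i) j =
      (if j = T.rootPerm r i then 1 else 0) - if ∃ e, i = Fin.succ e ∧ j = T.stdTail r e
        then 1 else 0 := by
    intro i j
    rw [hQ, Matrix.submatrix_apply, Equiv.symm_apply_apply]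
    refine Fin.cases ?_ (fun e => ?_) i
    · have : T.rootPerm r 0 = r := rfl
      simp [hN, this, Pi.single_apply, (Fin.succ_ne_zero _).symm]
    · have : T.rootPerm r e.succ = T.stdHead r e := rfl
      simp [hN, this, Pi.single_apply]
  have hlt : ∀ i j, (∃ e, i = Fin.succ e ∧ j = T.stdTail r e) →
      T.graph.dist r j < T.graph.dist r (T.rootPerm r i) := by
    rintro i j ⟨e, rfl, rfl⟩
    exact T.dist_stdTail_lt r e
  have hdet : Q.det = 1 := by
    have hb : Q.BlockTriangular fun v => OrderDual.toDual (T.graph.dist r v) := by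
      intro v u huv
      obtain ⟨i, rfl⟩ := (T.rootPerm r).surjective v
      have huv' : T.graph.dist r (T.rootPerm r i) < T.graph.dist r u := huv
      rw [hrow, if_neg, if_neg, sub_zero]
      · intro h
        exact absurd (hlt _ _ h) (by omega)
      · rintro rfl
        exact lt_irrefl _ huv'
    rw [hb.det]
    refine Finset.prod_eq_one fun d _ => ?_
    -- A parent never has the same distance as its child, so only the diagonal ones survive in a
    -- block.
    have : Q.toSquareBlock (fun v => OrderDual.toDual (T.graph.dist r v)) d = 1 := by
      ext ⟨v, hv⟩ ⟨u, hu⟩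
      obtain ⟨i, rfl⟩ := (T.rootPerm r).surjective v
      have hd : T.graph.dist r (T.rootPerm r i) = T.graph.dist r u :=
        OrderDual.toDual.injective (hv.trans hu.symm)
      rw [Matrix.toSquareBlock_def, Matrix.of_apply, hrow, if_neg (c := ∃ _, _), sub_zero,
        Matrix.one_apply]
      · simp [eq_comm]
      · intro h
        exact (hlt _ _ h).ne hd.symm
    rw [this, Matrix.det_one]
  rw [hNQ, Matrix.det_permute, hdet]
  simp

/-- The sign of a tree is the determinant of its incidence matrix. -/
theorem sgnAt_eq_det (T : DTree m) (r : Fin (m + 1)) :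
    T.sgnAt r = (T.incMatrix (Pi.single r 1)).det := by
  classical
  have h : T.incMatrix (Pi.single r 1) = Matrix.of fun i j =>
      (Fin.cons 1 (fun e => if T.IsReversed r e then -1 else 1) : Fin (m + 1) → ℤ) i *
      (Matrix.of (Fin.cons (Pi.single r 1) fun e =>
        Pi.single (T.stdHead r e) 1 - Pi.single (T.stdTail r e) 1) :
        Matrix (Fin (m + 1)) (Fin (m + 1)) ℤ) i j := by
    ext i j
    refine Fin.cases ?_ (fun e => ?_) i
    · simp [incMatrix]
    · by_cases he : T.IsReversed r e <;> simp [incMatrix, stdHead, stdTail, he]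
  rw [h, Matrix.det_mul_column, det_stdMatrix, sgnAt, Fin.prod_univ_succ]
  simp only [Fin.cons_zero, Fin.cons_succ, one_mul]
  rw [Finset.prod_ite]
  simp [Set.ncard_eq_toFinset_card']

theorem sgnAt_eq_sgn (T : DTree m) (r : Fin (m + 1)) : T.sgnAt r = T.sgn := by
  rw [sgn, sgnAt_eq_det, sgnAt_eq_det, det_incMatrix_root]

theorem IsReversal.sgn_eq {T T' : DTree m} (h : T.IsReversal T') : T'.sgn = -T.sgn := by
  obtain ⟨e, h1, h2⟩ := h
  rw [sgn, sgn, sgnAt_eq_det, sgnAt_eq_det]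
  have : T'.incMatrix (Pi.single 0 1) = (T.incMatrix (Pi.single 0 1)).updateRow e.succ
      ((-1 : ℤ) • T.incMatrix (Pi.single 0 1) e.succ) := by
    ext i : 1
    refine Fin.cases ?_ (fun g => ?_) i
    · rw [Matrix.updateRow_ne (Fin.succ_ne_zero e).symm]; rfl
    · by_cases hg : g = e
      · subst hg
        simp [incMatrix_succ, h1, h2]
      · rw [Matrix.updateRow_ne (by simpa using hg)]
        simp [incMatrix_succ, h1, h2, hg]
  rw [this, Matrix.det_updateRow_smul, Matrix.updateRow_eq_self]
  simp

/-- A slide of `e` along `f` adds plus or minus the row of `f` to the row of `e`. -/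
theorem IsSlide.sgn_eq {T T' : DTree m} (h : T.IsSlide T') : T'.sgn = T.sgn := by
  obtain ⟨e, f, q, r, hef, hf, h⟩ := h
  rw [sgn, sgn, sgnAt_eq_det, sgnAt_eq_det]
  have hrow : ∃ c : ℤ, (Pi.single r 1 - Pi.single q 1 : Fin (m + 1) → ℤ) =
      c • T.incMatrix (Pi.single 0 1) f.succ := by
    rw [Sym2.eq_iff] at hf
    rcases hf with ⟨h1, h2⟩ | ⟨h1, h2⟩
    · exact ⟨1, by rw [incMatrix_succ, h1, h2, one_smul]⟩
    · exact ⟨-1, by rw [incMatrix_succ, h1, h2]; simp⟩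
  obtain ⟨c, hc⟩ := hrow
  have : ∃ d : ℤ, T'.incMatrix (Pi.single 0 1) = (T.incMatrix (Pi.single 0 1)).updateRow e.succ
      (T.incMatrix (Pi.single 0 1) e.succ + d • T.incMatrix (Pi.single 0 1) f.succ) := by
    rcases h with ⟨h1, h2, h3⟩ | ⟨h1, h2, h3⟩
    · refine ⟨-c, ?_⟩
      ext i : 1
      refine Fin.cases ?_ (fun g => ?_) i
      · rw [Matrix.updateRow_ne (Fin.succ_ne_zero e).symm]; rfl
      · by_cases hg : g = e
        · subst hg
          rw [Matrix.updateRow_self, neg_smul, ← hc, incMatrix_succ, incMatrix_succ, h2, h3, h1,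
            Function.update_self]
          simp only [Pi.add_apply, Pi.sub_apply, Pi.neg_apply]
          ring
        · rw [Matrix.updateRow_ne (by simpa using hg)]
          simp [incMatrix_succ, h3, h2, hg]
    · refine ⟨c, ?_⟩
      ext i : 1
      refine Fin.cases ?_ (fun g => ?_) i
      · rw [Matrix.updateRow_ne (Fin.succ_ne_zero e).symm]; rfl
      · by_cases hg : g = e
        · subst hg
          rw [Matrix.updateRow_self, ← hc, incMatrix_succ, incMatrix_succ, h2, h3, h1,
            Function.update_self]
          simp only [Pi.add_apply, Pi.sub_apply]
          ring
        · rw [Matrix.updateRow_ne (by simpa using hg)]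
          simp [incMatrix_succ, h3, h2, hg]
  obtain ⟨d, hd⟩ := this
  rw [hd, Matrix.det_updateRow_add_smul_self _ (by simpa using hef)]

end DTree

/-! ### Special tree sequences and the sign-reversing involution -/

variable {m : ℕ}

theorem label_shiftSwap (i j : Fin m) (k : Fin m → ℤ) (v : Fin m) :
    label (shiftSwap i j k) v = label k (Equiv.swap i j v) := by
  unfold label shiftSwap
  by_cases hi : v = i
  · subst hi; simp
  by_cases hj : v = j
  · subst hj; simp [hi]
  · simp [hi, hj, Equiv.swap_apply_of_ne_of_ne hi hj]

theorem label_injective : Function.Injective (label : (Fin m → ℤ) → Fin m → ℤ) := by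
  intro k l h
  funext v
  have := congrFun h v
  simpa [label] using this

theorem shiftSwap_shiftSwap (i j : Fin m) (k : Fin m → ℤ) :
    shiftSwap i j (shiftSwap i j k) = k :=
  label_injective (funext fun v => by simp [label_shiftSwap])

namespace DTree

theorem IsFork.tail_ne {T : DTree m} {a b : Fin (m + 1)} {e f : Fin m}
    (h : T.IsFork a b e f) (g : Fin m) : T.tail g ≠ a ∧ T.tail g ≠ b := by
  have h2 := h.2.1
  have ha : a ∈ {v | ∀ e', T.tail e' ≠ v} := by rw [h2]; simp
  have hb : b ∈ {v | ∀ e', T.tail e' ≠ v} := by rw [h2]; simp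
  exact ⟨ha g, hb g⟩

theorem IsFork.edge_ne {T : DTree m} {a b : Fin (m + 1)} {e f : Fin m}
    (h : T.IsFork a b e f) : e ≠ f := by
  rintro rfl
  exact h.1 (((h.2.2.1 e).2 rfl).symm.trans ((h.2.2.2.1 e).2 rfl))

/-- The edges `e` and `f` share their tail and are the only ones that meet `a` or `b`, so swapping
the labels of the two sinks amounts to swapping the names `e` and `f`. Together with the analogue
for heads this carries admissibility and the number of inversions over. -/
theorem IsFork.label_tail {T : DTree m} {a b : Fin (m + 1)} {e f : Fin m}
    (h : T.IsFork a b e f) (k : Fin (m + 1) → ℤ) (g : Fin m) :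
    label (shiftSwap a b k) (T.tail g) = label k (T.tail (Equiv.swap e f g)) := by
  rw [label_shiftSwap, Equiv.swap_apply_of_ne_of_ne (h.tail_ne g).1 (h.tail_ne g).2]
  by_cases h1 : g = e
  · subst h1; rw [Equiv.swap_apply_left, h.2.2.2.2]
  by_cases h2 : g = f
  · subst h2; rw [Equiv.swap_apply_right, h.2.2.2.2]
  rw [Equiv.swap_apply_of_ne_of_ne h1 h2]

theorem IsFork.label_head {T : DTree m} {a b : Fin (m + 1)} {e f : Fin m}
    (h : T.IsFork a b e f) (k : Fin (m + 1) → ℤ) (g : Fin m) :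
    label (shiftSwap a b k) (T.head g) = label k (T.head (Equiv.swap e f g)) := by
  have he := (h.2.2.1 e).2 rfl
  have hf := (h.2.2.2.1 f).2 rfl
  rw [label_shiftSwap]
  by_cases h1 : g = e
  · subst h1; rw [Equiv.swap_apply_left, he, hf, Equiv.swap_apply_left]
  by_cases h2 : g = f
  · subst h2; rw [Equiv.swap_apply_right, he, hf, Equiv.swap_apply_right]
  rw [Equiv.swap_apply_of_ne_of_ne h1 h2, Equiv.swap_apply_of_ne_of_ne]
  · exact fun h3 => h1 ((h.2.2.1 g).1 h3)
  · exact fun h3 => h2 ((h.2.2.2.1 g).1 h3)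

theorem IsFork.admissible {T : DTree m} {a b : Fin (m + 1)} {e f : Fin m}
    (h : T.IsFork a b e f) {k : Fin (m + 1) → ℤ} {l : Fin m → ℤ} (hl : T.Admissible k l) :
    T.Admissible (shiftSwap a b k) (shiftSwap e f l) := by
  intro g
  rw [h.label_tail, h.label_head, label_shiftSwap]
  exact hl _

theorem IsFork.inv_eq {T : DTree m} {a b : Fin (m + 1)} {e f : Fin m}
    (h : T.IsFork a b e f) (k : Fin (m + 1) → ℤ) : T.inv (shiftSwap a b k) = T.inv k := by
  unfold inv
  have : {g | T.IsInversion (shiftSwap a b k) g} =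
      Equiv.swap e f '' {g | T.IsInversion k g} := by
    ext g
    rw [Equiv.image_eq_preimage_symm, Equiv.symm_swap]
    simp only [IsInversion, Set.mem_ofPred_eq, Set.mem_preimage, h.label_tail, h.label_head]
  rw [this, Set.ncard_image_of_injective _ (Equiv.injective _)]

theorem swap_tail_head (T : DTree 1) {a b : Fin 2} (hab : a ≠ b) (g : Fin 1) :
    Equiv.swap a b (T.tail g) = T.head g ∧ Equiv.swap a b (T.head g) = T.tail g := by
  have h := (T.adj g).ne
  generalize T.tail g = x at h ⊢
  generalize T.head g = y at h ⊢
  revert a b x y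
  decide

theorem label_ne_of_admissible {T : DTree m} {k : Fin (m + 1) → ℤ} {l : Fin m → ℤ}
    (hl : T.Admissible k l) (g : Fin m) : label k (T.tail g) ≠ label k (T.head g) := by
  intro h
  have := hl g
  rw [h, if_neg (lt_irrefl _)] at this
  omega

/-- The swap exchanges the labels at the ends of the only edge. These differ, since otherwise no
label would be admissible, and then the interval does not depend on their order. -/
theorem admissible_swap_of_one (T : DTree 1) {a b : Fin 2} (hab : a ≠ b) (c d : Fin 1)
    {k : Fin 2 → ℤ} {l : Fin 1 → ℤ} (hl : T.Admissible k l) :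
    T.Admissible (shiftSwap a b k) (shiftSwap c d l) := by
  intro g
  have h1 := label_ne_of_admissible hl g
  have h2 := hl g
  rw [label_shiftSwap, label_shiftSwap, (T.swap_tail_head hab g).1, (T.swap_tail_head hab g).2,
    label_shiftSwap, Subsingleton.elim (Equiv.swap c d g) g]
  split_ifs at h2 ⊢ <;> omega

/-- This is the sole source of the sign change: the tree with two vertices gains or loses its
inversion, while all forks keep theirs in number. -/
theorem inv_add_inv_of_one (T : DTree 1) {a b : Fin 2} (hab : a ≠ b)
    {k : Fin 2 → ℤ} {l : Fin 1 → ℤ} (hl : T.Admissible k l) :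
    T.inv (shiftSwap a b k) + T.inv k = 1 := by
  have h1 := label_ne_of_admissible hl 0
  have key : {e | T.IsInversion (shiftSwap a b k) e} = {e | T.IsInversion k e}ᶜ := by
    ext g
    rw [Subsingleton.elim g 0]
    simp only [IsInversion, Set.mem_ofPred_eq, Set.mem_compl_iff, label_shiftSwap,
      (T.swap_tail_head hab 0).1, (T.swap_tail_head hab 0).2]
    omega
  unfold inv
  rw [key, add_comm, Set.ncard_add_ncard_compl]
  simp

/-- The witness is a star with centre `ρ 0` whose first two edges point outwards to `a` and `b` and
whose other edges point to the centre. -/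
theorem exists_isFork (m : ℕ) (a b : Fin (m + 1)) :
    ∃ T : DTree m, a ≠ b → ∀ e f : Fin m, (e : ℕ) = 0 → (f : ℕ) = 1 → T.IsFork a b e f := by
  have hstar : ∀ (ρ : Equiv.Perm (Fin (m + 1))) (S : Set (Fin (m + 1))), 0 ∈ S →
      (∀ e : Fin m, ρ 0 ∈ S ↔ ρ e.succ ∈ S) → ∀ v, v ∈ S := by
    intro ρ S h0 h v
    have key : ∀ u, u ∈ S ↔ ρ 0 ∈ S := by
      intro u
      obtain ⟨w, rfl⟩ := ρ.surjective u
      refine Fin.cases Iff.rfl (fun e => (h e).symm) w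
    rw [key, ← key 0]
    exact h0
  have htree : ∀ ρ : Equiv.Perm (Fin (m + 1)), ∃ T : DTree m,
      (∀ e : Fin m, T.tail e = if (e : ℕ) < 2 then ρ 0 else ρ e.succ) ∧
      (∀ e : Fin m, T.head e = if (e : ℕ) < 2 then ρ e.succ else ρ 0) := by
    intro ρ
    refine ⟨⟨fun e => if (e : ℕ) < 2 then ρ 0 else ρ e.succ,
      fun e => if (e : ℕ) < 2 then ρ e.succ else ρ 0,
      isTree_of_closed _ _ fun S h0 h => hstar ρ S h0 fun e => ?_⟩, fun _ => rfl, fun _ => rfl⟩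
    have := h e
    split_ifs at this
    · exact this
    · exact this.symm
  by_cases hm : m < 2
  · obtain ⟨T, -⟩ := htree 1
    exact ⟨T, fun _ e f _ _ => by omega⟩
  obtain ⟨m, rfl⟩ := Nat.exists_eq_add_of_le' (not_lt.1 hm)
  by_cases hab : a = b
  · obtain ⟨T, -⟩ := htree 1
    exact ⟨T, fun h => absurd hab h⟩
  have v0 : ((0 : Fin (m + 2 + 1)) : ℕ) = 0 := rfl
  have v1 : ((1 : Fin (m + 2 + 1)) : ℕ) = 1 := rfl
  have v2 : ((2 : Fin (m + 2 + 1)) : ℕ) = 2 := Nat.mod_eq_of_lt (show 2 < m + 2 + 1 by omega)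
  have hρ : ∃ ρ : Equiv.Perm (Fin (m + 2 + 1)), ρ 1 = a ∧ ρ 2 = b := by
    -- The right factor sends `1` to `a`; the left one corrects the image of `2` to `b` and leaves
    -- `a` alone.
    refine ⟨Equiv.swap (Equiv.swap 1 a 2) b * Equiv.swap 1 a, ?_, by simp⟩
    rw [Equiv.Perm.mul_apply, Equiv.swap_apply_left]
    refine Equiv.swap_apply_of_ne_of_ne (fun h => ?_) hab
    have h' : Equiv.swap 1 a 1 = Equiv.swap 1 a (2 : Fin (m + 2 + 1)) := by
      rw [Equiv.swap_apply_left, ← h]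
    have := (Equiv.swap 1 a).injective h'
    rw [Fin.ext_iff, v1, v2] at this
    omega
  obtain ⟨ρ, rfl, rfl⟩ := hρ
  obtain ⟨T, ht, hh⟩ := htree ρ
  refine ⟨T, fun hab e f he hf => ⟨hab, ?_, fun g => ?_, fun g => ?_, ?_⟩⟩
  · ext v
    obtain ⟨w, rfl⟩ := ρ.surjective v
    simp only [Set.mem_ofPred_eq, Set.mem_insert_iff, Set.mem_singleton_iff,
      EmbeddingLike.apply_eq_iff_eq, ht]
    constructor
    · intro h
      by_contra hcon
      push Not at hcon
      have h0 : w ≠ 0 := by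
        rintro rfl
        have := h e
        rw [if_pos (by omega)] at this
        exact this rfl
      obtain ⟨x, rfl⟩ := Fin.exists_succ_eq.2 h0
      have := h x
      rw [if_neg] at this
      · exact this rfl
      · simp only [Ne, Fin.ext_iff, Fin.val_succ, v1, v2] at hcon
        omega
    · intro h g
      split_ifs with hg
      · rw [Ne, EmbeddingLike.apply_eq_iff_eq]
        rcases h with rfl | rfl <;> simp only [Fin.ext_iff, v0, v1, v2] <;> omega
      · rw [Ne, EmbeddingLike.apply_eq_iff_eq]
        rcases h with rfl | rfl <;> simp only [Fin.ext_iff, Fin.val_succ, v1, v2] <;>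
          omega
  · rw [hh]
    split_ifs with hg <;> rw [EmbeddingLike.apply_eq_iff_eq] <;>
      simp only [Fin.ext_iff, Fin.val_succ, v0, v1] <;> omega
  · rw [hh]
    split_ifs with hg <;> rw [EmbeddingLike.apply_eq_iff_eq] <;>
      simp only [Fin.ext_iff, Fin.val_succ, v0, v2] <;> omega
  · rw [ht, ht, if_pos (by omega), if_pos (by omega)]

end DTree

variable {n : ℕ}

theorem exists_isForkSeq (i j : Fin (n + 1)) (hij : i < j) :
    ∃ (S : TreeSeq n) (a b : (m : Fin (n + 1)) → Fin (m + 1)), IsForkSeq S i j a b := by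
  -- Below the largest tree the first two vertices are distinguished; `min 1 m` allows for the tree
  -- with a single vertex.
  let a : (m : Fin (n + 1)) → Fin (m + 1) := fun m =>
    ⟨if (m : ℕ) = n then i else 0, by split_ifs <;> omega⟩
  let b : (m : Fin (n + 1)) → Fin (m + 1) := fun m =>
    ⟨if (m : ℕ) = n then j else min 1 m, by split_ifs <;> omega⟩
  choose S hS using fun m : Fin (n + 1) => DTree.exists_isFork m (a m) (b m)
  refine ⟨S, a, b, by simp [a], by simp [b], fun m hm => hS m.succ ?_ _ _ ?_ ?_⟩
  · simp only [a, b, Ne, Fin.ext_iff, Fin.val_succ]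
    have : (i : ℕ) < j := hij
    split_ifs <;> omega
  · have := m.isLt
    simp only [a, Fin.val_castSucc]
    rw [if_neg (by omega)]
  · have := m.isLt
    simp only [b, Fin.val_castSucc]
    rw [if_neg (by omega)]
    omega

namespace IsForkSeq

variable {S : TreeSeq n} {i j : Fin (n + 1)} {a b : (m : Fin (n + 1)) → Fin (m + 1)}

/-- The tree with two vertices is not required to be a fork. Its distinguished vertices differ
because they are `i` and `j`, or because they name the two different sink edges of the next larger
tree. -/
theorem ne (h : IsForkSeq S i j a b) (hij : i ≠ j) (m : Fin n) : a m.succ ≠ b m.succ := by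
  by_cases hm : (m : ℕ) = 0
  · rcases n with _ | _ | n
    · exact m.elim0
    · obtain rfl : m = 0 := Fin.ext hm
      intro h'
      exact hij (h.top_left.symm.trans (h'.trans h.top_right))
    · obtain rfl : m = 0 := Fin.ext hm
      exact (h.fork 1 (by simp)).edge_ne
  · exact (h.fork m (by omega)).1

theorem admissible (h : IsForkSeq S i j a b) (hij : i ≠ j) (m : Fin n)
    {k : Fin (m + 1 + 1) → ℤ} {l : Fin (m + 1) → ℤ} (hl : (S m.succ).Admissible k l) :
    (S m.succ).Admissible (shiftSwap (a m.succ) (b m.succ) k)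
      (shiftSwap (a m.castSucc) (b m.castSucc) l) := by
  by_cases hm : (m : ℕ) = 0
  · rcases n with _ | n
    · exact m.elim0
    · obtain rfl : m = 0 := Fin.ext hm
      exact DTree.admissible_swap_of_one _ (h.ne hij 0) _ _ hl
  · exact (h.fork m (by omega)).admissible hl

/-- The involution that interchanges the two distinguished labels in all trees. -/
def swapSeq (h : IsForkSeq S i j a b) (hij : i ≠ j) {k : Fin (n + 1) → ℤ} (L : GTSeq S k) :
    GTSeq S (shiftSwap i j k) where
  lab m := shiftSwap (a m) (b m) (L.lab m)
  top := by rw [L.top, h.top_left, h.top_right]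
  adm m := h.admissible hij m (L.adm m)

theorem sgn_swapSeq (h : IsForkSeq S i j a b) (hij : i ≠ j) {k : Fin (n + 1) → ℤ}
    (L : GTSeq S k) : (h.swapSeq hij L).sgn = -L.sgn := by
  rcases n with _ | n
  · exact absurd (Fin.ext (by omega)) hij
  unfold GTSeq.sgn
  have h1 : ∀ m : Fin n, (S m.succ.succ).inv ((h.swapSeq hij L).lab m.succ.succ) =
      (S m.succ.succ).inv (L.lab m.succ.succ) := fun m =>
    (h.fork m.succ (by simp)).inv_eq _
  have h2 : (S (Fin.succ 0)).inv ((h.swapSeq hij L).lab (Fin.succ 0)) +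
      (S (Fin.succ 0)).inv (L.lab (Fin.succ 0)) = 1 :=
    DTree.inv_add_inv_of_one _ (h.ne hij 0) (L.adm 0)
  rw [Fin.sum_univ_succ, Fin.sum_univ_succ, Finset.sum_congr rfl fun m _ => h1 m]
  generalize (S (Fin.succ 0)).inv ((h.swapSeq hij L).lab (Fin.succ 0)) = x at h2 ⊢
  generalize (S (Fin.succ 0)).inv (L.lab (Fin.succ 0)) = y at h2 ⊢
  rcases y with _ | y
  · obtain rfl : x = 1 := by omega
    rw [pow_add, pow_add]
    simp
  · obtain rfl : x = 0 := by omega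
    obtain rfl : y = 0 := by omega
    rw [pow_add, pow_add]
    simp

theorem exists_swapSeq (h : IsForkSeq S i j a b) (hij : i ≠ j) :
    ∃ Φ : (k : Fin (n + 1) → ℤ) → GTSeq S k → GTSeq S (shiftSwap i j k),
      (∀ k L m, (Φ k L).lab m = shiftSwap (a m) (b m) (L.lab m)) ∧
      (∀ k L, (Φ k L).sgn = - L.sgn) ∧
      (∀ k L, (Φ (shiftSwap i j k) (Φ k L)).lab = L.lab) :=
  ⟨fun _ L => h.swapSeq hij L, fun _ _ _ => rfl, fun _ L => h.sgn_swapSeq hij L,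
    fun _ _ => funext fun _ => shiftSwap_shiftSwap _ _ _⟩

theorem signedCount_eq_neg (h : IsForkSeq S i j a b) (hij : i ≠ j) (k : Fin (n + 1) → ℤ) :
    signedCount S k = -signedCount S (shiftSwap i j k) := by
  have hbij : Function.Bijective (h.swapSeq hij : GTSeq S k → GTSeq S (shiftSwap i j k)) := by
    constructor
    · intro L L' hL
      ext m : 2
      have := congrArg (fun L => shiftSwap (a m) (b m) (L.lab m)) hL
      simpa [swapSeq, shiftSwap_shiftSwap] using this
    · intro L
      refine ⟨⟨fun m => shiftSwap (a m) (b m) (L.lab m), ?_,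
        fun m => h.admissible hij m (L.adm m)⟩, ?_⟩
      · rw [L.top, h.top_left, h.top_right]
        exact shiftSwap_shiftSwap i j k
      · ext m : 2
        simp [swapSeq, shiftSwap_shiftSwap]
  unfold signedCount
  rw [← finsum_neg_distrib]
  refine finsum_eq_of_bijective _ hbij fun L => ?_
  rw [sgn_swapSeq, neg_neg]

end IsForkSeq

/-! ### Signed weights and their change under reversals and slides -/

/-- The signed indicator function of the interval from `x` to `y`. -/
def signedInd (x y t : ℤ) : ℤ := (if t < y then 1 else 0) - (if t < x then 1 else 0)

theorem signedInd_swap (x y t : ℤ) : signedInd y x t = -signedInd x y t := by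
  unfold signedInd; ring

theorem signedInd_add (x y z t : ℤ) : signedInd x y t + signedInd y z t = signedInd x z t := by
  unfold signedInd; ring

namespace DTree

variable {m : ℕ}

/-- The signed indicator function of the admissible edge labels. -/
def weight (T : DTree m) (K : Fin (m + 1) → ℤ) (x : Fin m → ℤ) : ℤ :=
  ∏ e, signedInd (K (T.tail e)) (K (T.head e)) (x e)

open Classical in
-- The half-open intervals of admissibility are exactly the supports of the factors, with value `-1`
-- at an inversion; for equal end labels the factor vanishes and the interval is empty.
theorem weight_label (T : DTree m) (k : Fin (m + 1) → ℤ) (l : Fin m → ℤ) :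
    T.weight (label k) (label l) = if T.Admissible k l then (-1) ^ T.inv k else 0 := by
  split_ifs with h
  · have h1 : ∀ e, signedInd (label k (T.tail e)) (label k (T.head e)) (label l e) =
        if T.IsInversion k e then -1 else 1 := by
      intro e
      have := h e
      unfold signedInd IsInversion
      split_ifs at this ⊢ <;> omega
    rw [weight, Finset.prod_congr rfl fun e _ => h1 e, Finset.prod_ite]
    simp [inv, Set.ncard_eq_toFinset_card']
  · unfold Admissible at h
    push Not at h
    obtain ⟨e, he⟩ := h
    refine Finset.prod_eq_zero (Finset.mem_univ e) ?_
    unfold signedInd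
    split_ifs at he ⊢ <;> omega

theorem IsReversal.weight_eq {T T' : DTree m} (h : T.IsReversal T') (K : Fin (m + 1) → ℤ)
    (x : Fin m → ℤ) : T'.weight K x = -T.weight K x := by
  obtain ⟨e, h1, h2⟩ := h
  rw [weight, weight, ← Finset.mul_prod_erase _ _ (Finset.mem_univ e),
    ← Finset.mul_prod_erase (a := e) _ _ (Finset.mem_univ e), ← neg_mul, ← signedInd_swap]
  congr 1
  · rw [h1, h2, Function.update_self, Function.update_self]
  · refine Finset.prod_congr rfl fun g hg => ?_
    rw [h1, h2, Function.update_of_ne (Finset.ne_of_mem_erase hg),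
      Function.update_of_ne (Finset.ne_of_mem_erase hg)]

theorem prod_eq_mul_mul_prod_erase (F : Fin m → ℤ) {e f : Fin m} (hef : e ≠ f) :
    ∏ g, F g = F e * (F f * ∏ g ∈ (Finset.univ.erase e).erase f, F g) := by
  rw [Finset.mul_prod_erase _ _ (Finset.mem_erase.2 ⟨hef.symm, Finset.mem_univ f⟩),
    Finset.mul_prod_erase _ _ (Finset.mem_univ e)]

/-- The effect of a slide on the weight is symmetric in the labels of the two edges. -/
theorem IsSlide.exists_weight_eq {T T' : DTree m} (h : T.IsSlide T') (K : Fin (m + 1) → ℤ) :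
    ∃ (e f : Fin m) (D : (Fin m → ℤ) → ℤ), e ≠ f ∧ (∀ x, D (x ∘ Equiv.swap e f) = D x) ∧
      ∀ x, T'.weight K x = T.weight K x + D x := by
  obtain ⟨e, f, q, r, hef, hf, h⟩ := h
  -- By additivity the factor of `e` changes by a multiple of the indicator between `q` and `r`. The
  -- factor of `f` is a multiple of the same indicator, so the change of the product is symmetric in
  -- `x e` and `x f`.
  have hc : ∃ c : ℤ, ∀ t, signedInd (K (T'.tail e)) (K (T'.head e)) t =
      signedInd (K (T.tail e)) (K (T.head e)) t + c * signedInd (K q) (K r) t := by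
    rcases h with ⟨h1, h2, h3⟩ | ⟨h1, h2, h3⟩
    · refine ⟨-1, fun t => ?_⟩
      rw [h2, h3, Function.update_self, h1, ← signedInd_add (K q) (K r) (K (T.head e))]
      ring
    · refine ⟨1, fun t => ?_⟩
      rw [h2, h3, Function.update_self, h1, ← signedInd_add (K (T.tail e)) (K q) (K r)]
      ring
  have hd : ∃ d : ℤ, ∀ t, signedInd (K (T.tail f)) (K (T.head f)) t =
      d * signedInd (K q) (K r) t := by
    rw [Sym2.eq_iff] at hf
    rcases hf with ⟨h1, h2⟩ | ⟨h1, h2⟩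
    · exact ⟨1, fun t => by rw [h1, h2, one_mul]⟩
    · exact ⟨-1, fun t => by rw [h1, h2, signedInd_swap, neg_one_mul]⟩
  have hne : ∀ g, g ≠ e → T'.tail g = T.tail g ∧ T'.head g = T.head g := by
    intro g hg
    rcases h with ⟨h1, h2, h3⟩ | ⟨h1, h2, h3⟩ <;> simp [h2, h3, hg]
  obtain ⟨c, hc⟩ := hc
  obtain ⟨d, hd⟩ := hd
  refine ⟨e, f, fun x => c * d * (signedInd (K q) (K r) (x e) * (signedInd (K q) (K r) (x f) *
    ∏ g ∈ (Finset.univ.erase e).erase f, signedInd (K (T.tail g)) (K (T.head g)) (x g))),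
    hef, fun x => ?_, fun x => ?_⟩
  · simp only [Function.comp_apply, Equiv.swap_apply_left, Equiv.swap_apply_right]
    have : ∀ g ∈ (Finset.univ.erase e).erase f,
        signedInd (K (T.tail g)) (K (T.head g)) (x (Equiv.swap e f g)) =
        signedInd (K (T.tail g)) (K (T.head g)) (x g) := by
      intro g hg
      rw [Finset.mem_erase, Finset.mem_erase] at hg
      rw [Equiv.swap_apply_of_ne_of_ne hg.2.1 hg.1]
    rw [Finset.prod_congr rfl this]
    ring
  · have : ∀ g ∈ (Finset.univ.erase e).erase f,
        signedInd (K (T'.tail g)) (K (T'.head g)) (x g) =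
        signedInd (K (T.tail g)) (K (T.head g)) (x g) := by
      intro g hg
      rw [Finset.mem_erase, Finset.mem_erase] at hg
      rw [(hne g hg.2.1).1, (hne g hg.2.1).2]
    rw [weight, weight, prod_eq_mul_mul_prod_erase _ hef, prod_eq_mul_mul_prod_erase _ hef,
      Finset.prod_congr rfl this, hc, (hne f hef.symm).1, (hne f hef.symm).2, hd]
    ring

/-- The weighted sum of an antisymmetric function, multiplied by the sign of the tree, is the same
for all trees. -/
theorem sgn_mul_sum_weight (T T' : DTree m) (K : Fin (m + 1) → ℤ) (g : (Fin m → ℤ) → ℤ)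
    (hg : ∀ e f, e ≠ f → ∀ x, g (x ∘ Equiv.swap e f) = -g x) (lo hi : ℤ) :
    T.sgn * ∑ x ∈ Fintype.piFinset fun _ => Finset.Ico lo hi, T.weight K x * g x =
      T'.sgn * ∑ x ∈ Fintype.piFinset fun _ => Finset.Ico lo hi, T'.weight K x * g x := by
  induction T.reach T' with
  | refl => rfl
  | @tail U V _ hstep ih =>
    rw [ih]
    rcases hstep with h | h
    · simp only [h.sgn_eq, h.weight_eq, neg_mul, Finset.sum_neg_distrib, mul_neg, neg_neg]
    · obtain ⟨e, f, D, hef, hD, hw⟩ := h.exists_weight_eq K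
      -- Exchanging the coordinates `e` and `f` preserves the box and `D` but negates `g`, so this
      -- sum is its own negative and vanishes.
      have h0 : ∑ x ∈ Fintype.piFinset fun _ => Finset.Ico lo hi, D x * g x =
          -∑ x ∈ Fintype.piFinset fun _ => Finset.Ico lo hi, D x * g x := by
        rw [← Finset.sum_neg_distrib]
        refine Finset.sum_bij' (fun x _ => x ∘ Equiv.swap e f) (fun x _ => x ∘ Equiv.swap e f)
          ?_ ?_ ?_ ?_ ?_
        · intro x hx
          rw [Fintype.mem_piFinset] at hx ⊢
          exact fun i => hx _
        · intro x hx
          rw [Fintype.mem_piFinset] at hx ⊢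
          exact fun i => hx _
        · intro x _
          funext i
          simp
        · intro x _
          funext i
          simp
        · intro x _
          rw [hD, hg e f hef]
          ring
      rw [h.sgn_eq]
      congr 1
      simp only [hw, add_mul, Finset.sum_add_distrib]
      omega

end DTree

/-! ### Recursion over the largest tree and the final induction -/

/-- The labeling `k` with `label k = x`. -/
def unlabel {m : ℕ} (x : Fin m → ℤ) : Fin m → ℤ := fun i => x i - ((i : ℕ) : ℤ) - 1

theorem label_unlabel {m : ℕ} (x : Fin m → ℤ) : label (unlabel x) = x := by
  funext i
  simp only [label, unlabel]
  ring

theorem unlabel_label {m : ℕ} (k : Fin m → ℤ) : unlabel (label k) = k := by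
  funext i
  simp only [label, unlabel]
  ring

theorem unlabel_comp_swap {m : ℕ} (e f : Fin m) (x : Fin m → ℤ) :
    unlabel (x ∘ Equiv.swap e f) = shiftSwap e f (unlabel x) :=
  label_injective (funext fun v => by simp [label_shiftSwap, label_unlabel])

theorem shiftSwap_comm {m : ℕ} (e f : Fin m) : shiftSwap e f = shiftSwap f e :=
  funext fun k => label_injective (funext fun v => by simp [label_shiftSwap, Equiv.swap_comm])

variable {n : ℕ}

/-- The tree sequence without its largest tree. -/
def TreeSeq.init (T : TreeSeq (n + 1)) : TreeSeq n := fun m => T m.castSucc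

/-- The largest tree of a tree sequence. -/
def TreeSeq.last (T : TreeSeq n) : DTree n := T (Fin.last n)

theorem TreeSeq.sgn_eq (T : TreeSeq (n + 1)) : T.sgn = T.init.sgn * T.last.sgn :=
  Fin.prod_univ_castSucc _

namespace GTSeq

variable {T : TreeSeq (n + 1)} {k : Fin (n + 2) → ℤ} {l : Fin (n + 1) → ℤ}

/-- The labels of a Gelfand-Tsetlin tree sequence with one more tree. -/
def snocLab (k : Fin (n + 2) → ℤ) (lab : (m : Fin (n + 1)) → Fin (m + 1) → ℤ) :
    (m : Fin (n + 2)) → Fin (m + 1) → ℤ :=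
  Fin.lastCases (motive := fun m : Fin (n + 2) => Fin (m + 1) → ℤ) k lab

theorem snocLab_last (k : Fin (n + 2) → ℤ) (lab : (m : Fin (n + 1)) → Fin (m + 1) → ℤ) :
    snocLab k lab (Fin.last (n + 1)) = k :=
  Fin.lastCases_last (motive := fun m : Fin (n + 2) => Fin (m + 1) → ℤ)

theorem snocLab_castSucc (k : Fin (n + 2) → ℤ) (lab : (m : Fin (n + 1)) → Fin (m + 1) → ℤ)
    (m : Fin (n + 1)) : snocLab k lab m.castSucc = lab m :=
  Fin.lastCases_castSucc (motive := fun m : Fin (n + 2) => Fin (m + 1) → ℤ) _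

/-- The extension of a Gelfand-Tsetlin tree sequence by a largest tree. -/
def snoc (M : GTSeq T.init l) (h : T.last.Admissible k l) : GTSeq T k where
  lab := snocLab k M.lab
  top := snocLab_last _ _
  adm m := by
    induction m using Fin.lastCases with
    | last =>
      have : (T (Fin.last (n + 1))).Admissible (snocLab k M.lab (Fin.last (n + 1)))
          (snocLab k M.lab (Fin.last n).castSucc) := by
        rw [snocLab_last, snocLab_castSucc, M.top]
        exact h
      exact this
    | cast m =>
      have : (T m.succ.castSucc).Admissible (snocLab k M.lab m.succ.castSucc)
          (snocLab k M.lab m.castSucc.castSucc) := by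
        rw [snocLab_castSucc, snocLab_castSucc]
        exact M.adm m
      exact this

theorem sgn_snoc (M : GTSeq T.init l) (h : T.last.Admissible k l) :
    (M.snoc h).sgn = T.last.sgn * ((-1) ^ T.last.inv k * M.sgn) := by
  have h1 : (T (Fin.last (n + 1))).inv ((M.snoc h).lab (Fin.last (n + 1))) = T.last.inv k := by
    rw [show (M.snoc h).lab (Fin.last (n + 1)) = k from snocLab_last _ _]
    rfl
  have h2 : ∀ m : Fin n, (T m.succ.castSucc).inv ((M.snoc h).lab m.succ.castSucc) =
      (T.init m.succ).inv (M.lab m.succ) := by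
    intro m
    rw [show (M.snoc h).lab m.succ.castSucc = M.lab m.succ from snocLab_castSucc _ _ _]
    rfl
  have h3 : ∑ m : Fin (n + 1), (T m.succ).inv ((M.snoc h).lab m.succ) =
      ∑ m : Fin n, (T.init m.succ).inv (M.lab m.succ) + T.last.inv k := by
    rw [Fin.sum_univ_castSucc]
    exact congrArg₂ _ (Finset.sum_congr rfl fun m _ => h2 m) h1
  rw [sgn, sgn, h3, TreeSeq.sgn_eq, pow_add]
  ring

end GTSeq

/-- A sequence is an admissible labeling of the edges of the largest tree together with a sequence
below it. The box is the same for all trees and contains every admissible labeling, so sums for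
different trees can be compared; its upper end is excluded because admissible labels lie strictly
below the larger end label. -/
theorem signedCount_succ (T : TreeSeq (n + 1)) (k : Fin (n + 2) → ℤ) (lo hi : ℤ)
    (hk : ∀ i, lo ≤ label k i ∧ label k i ≤ hi) :
    signedCount T k = T.last.sgn * ∑ x ∈ Fintype.piFinset fun _ => Finset.Ico lo hi,
      T.last.weight (label k) x * signedCount T.init (unlabel x) := by
  classical
  let B := (Fintype.piFinset fun _ : Fin (n + 1) => Finset.Ico lo hi).filter
    fun x => T.last.Admissible k (unlabel x)
  have hB : ∀ x : B, T.last.Admissible k (unlabel x.1) := fun x => (Finset.mem_filter.1 x.2).2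
  let G : (Σ x : B, GTSeq T.init (unlabel x.1)) → GTSeq T k := fun p => p.2.snoc (hB p.1)
  have hG : Function.Bijective G := by
    constructor
    · rintro ⟨⟨x, hx⟩, M⟩ ⟨⟨x', hx'⟩, M'⟩ h
      have hlab : M.lab = M'.lab := by
        funext m
        have := congrArg (fun L => L.lab m.castSucc) h
        change GTSeq.snocLab k M.lab m.castSucc = GTSeq.snocLab k M'.lab m.castSucc at this
        rwa [GTSeq.snocLab_castSucc, GTSeq.snocLab_castSucc] at this
      obtain rfl : x = x' := by
        rw [← label_unlabel x, ← label_unlabel x']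
        change label (unlabel x) = label (unlabel x')
        rw [← M.top, ← M'.top, hlab]
      obtain rfl : M = M' := GTSeq.ext hlab
      rfl
    · intro L
      have hadm : T.last.Admissible k (L.lab (Fin.last n).castSucc) := by
        have := L.adm (Fin.last n)
        rw [show L.lab (Fin.last n).succ = k from L.top] at this
        exact this
      have hadm' : T.last.Admissible k (unlabel (label (L.lab (Fin.last n).castSucc))) := by
        rwa [unlabel_label]
      have hx : label (L.lab (Fin.last n).castSucc) ∈ B := by
        refine Finset.mem_filter.2 ⟨Fintype.mem_piFinset.2 fun e => ?_, hadm'⟩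
        have h1 := hadm e
        have h2 := hk (T.last.tail e)
        have h3 := hk (T.last.head e)
        rw [Finset.mem_Ico]
        change lo ≤ label (m := n + 1) (L.lab (Fin.last n).castSucc) e ∧
          label (m := n + 1) (L.lab (Fin.last n).castSucc) e < hi
        split_ifs at h1 <;> omega
      refine ⟨⟨⟨_, hx⟩, ⟨fun m => L.lab m.castSucc, (unlabel_label _).symm,
        fun m => L.adm m.castSucc⟩⟩, ?_⟩
      refine GTSeq.ext (funext fun m => ?_)
      induction m using Fin.lastCases with
      | last => exact (GTSeq.snocLab_last _ _).trans L.top.symm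
      | cast m => exact GTSeq.snocLab_castSucc _ _ _
  have : ∀ x, Fintype (GTSeq T.init (unlabel x)) := fun x => Fintype.ofFinite _
  rw [signedCount, ← finsum_eq_of_bijective (f := fun p => (G p).sgn) G hG fun _ => rfl,
    finsum_eq_sum_of_fintype, Fintype.sum_sigma]
  simp only [G, GTSeq.sgn_snoc, ← Finset.mul_sum]
  congr 1
  rw [Finset.sum_coe_sort B fun x => ∑ M : GTSeq T.init (unlabel x), M.sgn, Finset.mul_sum,
    Finset.sum_filter]
  refine Finset.sum_congr rfl fun x _ => ?_
  conv_rhs => rw [← label_unlabel x, DTree.weight_label, label_unlabel]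
  rw [signedCount, finsum_eq_sum_of_fintype, ite_mul, zero_mul]

/-- Independency allows `T` to be replaced by a special sequence for `(i, j)`, where the involution
applies. It is assumed only for the order at hand, so that this can be used inside the induction. -/
theorem signedCount_shiftSwap_of_indep
    (hind : ∀ (T T' : TreeSeq n) (k : Fin (n + 1) → ℤ), signedCount T k = signedCount T' k)
    (T : TreeSeq n) {i j : Fin (n + 1)} (hij : i ≠ j) (k : Fin (n + 1) → ℤ) :
    signedCount T (shiftSwap i j k) = -signedCount T k := by
  wlog h : i < j generalizing i j
  · rw [shiftSwap_comm]
    exact this hij.symm (lt_of_le_of_ne (not_lt.1 h) hij.symm)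
  obtain ⟨S, a, b, hS⟩ := exists_isForkSeq i j h
  rw [hind T S, hind T S, hS.signedCount_eq_neg hij k, neg_neg]

theorem signedCount_indep (T T' : TreeSeq n) (k : Fin (n + 1) → ℤ) :
    signedCount T k = signedCount T' k := by
  induction n with
  | zero =>
    obtain rfl : T = T' := funext fun m => DTree.ext_of_eq
      (funext fun e => absurd e.isLt (by omega)) (funext fun e => absurd e.isLt (by omega))
    rfl
  | succ n ih =>
    obtain ⟨hi, hhi⟩ := (Set.finite_range (label k)).bddAbove
    obtain ⟨lo, hlo⟩ := (Set.finite_range (label k)).bddBelow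
    have hk : ∀ i, lo ≤ label k i ∧ label k i ≤ hi := fun i => ⟨hlo ⟨i, rfl⟩, hhi ⟨i, rfl⟩⟩
    rw [signedCount_succ T k lo hi hk, signedCount_succ T' k lo hi hk,
      -- Now both sides sum against the same function, and only the largest trees differ.
      funext fun l => ih T.init T'.init l]
    refine DTree.sgn_mul_sum_weight _ _ _ (fun x => signedCount T'.init (unlabel x))
      (fun e f hef x => ?_) _ _
    rw [unlabel_comp_swap, signedCount_shiftSwap_of_indep ih _ hef]

end GelfandTsetlin

open GelfandTsetlin
theorem lemma1 (n : ℕ) :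
    -- independency
    (∀ (T T' : TreeSeq n) (k : Fin (n + 1) → ℤ), signedCount T k = signedCount T' k) ∧
    -- shift-antisymmetry
    (∀ T : TreeSeq n, ShiftAntisymmetric (fun k : Fin (n + 1) → ℤ => signedCount T k)) ∧
    -- the special tree sequences exist, and interchanging the two distinguished labels in all
    -- trees is a sign-reversing involution
    (∀ i j : Fin (n + 1), i < j →
      (∃ (S : TreeSeq n) (a b : (m : Fin (n + 1)) → Fin (m + 1)), IsForkSeq S i j a b) ∧
      ∀ (S : TreeSeq n) (a b : (m : Fin (n + 1)) → Fin (m + 1)), IsForkSeq S i j a b →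
        ∃ Φ : (k : Fin (n + 1) → ℤ) → GTSeq S k → GTSeq S (shiftSwap i j k),
          (∀ k L m, (Φ k L).lab m = shiftSwap (a m) (b m) (L.lab m)) ∧
          (∀ k L, (Φ k L).sgn = - L.sgn) ∧
          (∀ k L, (Φ (shiftSwap i j k) (Φ k L)).lab = L.lab)) ∧
    -- the sign of a tree does not depend on the choice of the root
    (∀ (T : DTree n) (r : Fin (n + 1)), T.sgnAt r = T.sgn) ∧
    -- every tree can be reached from every other by edge reversals and edge slides
    (∀ T T' : DTree n,
      Relation.ReflTransGen (fun U V : DTree n => U.IsReversal V ∨ U.IsSlide V) T T') := by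
  refine ⟨signedCount_indep, fun T i j hij k => ?_, fun i j hij => ⟨exists_isForkSeq i j hij,
    fun S a b hS => hS.exists_swapSeq hij.ne⟩, DTree.sgnAt_eq_sgn, DTree.reach⟩
  simp only [signedCount_shiftSwap_of_indep signedCount_indep T hij.ne, neg_neg]
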